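/- Let $\beta\in(1,2)$ and $\tau\in(0,1/2)$, and let $f:[0,1]^2\to[0,1]^2$ be the map \[ f(x,y)=\begin{cases}(\beta x,\ \tau y), & x\in[0,\beta^{-1}],\\ (\beta x-1,\ \tau y+(1-\tau)), & x\in(\beta^{-1},1].\end{cases} \] Let $\Lambda_{\beta,\tau}=\overline{\bigcap_{i=0}^{\infty}f^i([0,1]^2)}\subset\mathbb{R}^2$ be its attractor. Then the Hausdorff dimension of $\Lambda_{\beta,\tau}$ is \[ \dim_H\Lambda_{\beta,\tau}=1+\frac{\log\beta}{\log\tau^{-1}}. \] -/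

import Mathlib

/-- The closed unit square `[0,1]²` in the Euclidean plane. -/
def unitSquare : Set (EuclideanSpace ℝ (Fin 2)) :=
  {p | p 0 ∈ Set.Icc (0 : ℝ) 1 ∧ p 1 ∈ Set.Icc (0 : ℝ) 1}

/-- The piecewise affine map `f(x, y) = (βx, τy)` for `x ≤ β⁻¹` and
`f(x, y) = (βx - 1, τy + (1 - τ))` for `x > β⁻¹`. It is only ever applied to points of the unit
square, which it maps into itself (`mapsTo_betaMap_unitSquare`). -/
noncomputable def betaMap (β τ : ℝ) (p : EuclideanSpace ℝ (Fin 2)) : EuclideanSpace ℝ (Fin 2) :=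
  if p 0 ≤ β⁻¹ then !₂[β * p 0, τ * p 1]
  else !₂[β * p 0 - 1, τ * p 1 + (1 - τ)]

/-- The attractor: the closure of the intersection of all forward images of the unit square. -/
noncomputable def betaAttractor (β τ : ℝ) : Set (EuclideanSpace ℝ (Fin 2)) :=
  closure (⋂ i : ℕ, (betaMap β τ)^[i] '' unitSquare)

/-- The map is a self-map of the unit square for the parameters considered. -/
theorem mapsTo_betaMap_unitSquare {β τ : ℝ} (hβ : β ∈ Set.Ioo (1 : ℝ) 2)
    (hτ : τ ∈ Set.Ioo (0 : ℝ) (1 / 2)) :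
    Set.MapsTo (betaMap β τ) unitSquare unitSquare := by
  obtain ⟨hβ1, hβ2⟩ := hβ
  obtain ⟨hτ1, hτ2⟩ := hτ
  rintro p ⟨⟨hx0, hx1⟩, hy0, hy1⟩
  have hβ0 : 0 < β := by linarith
  have hc : β * β⁻¹ = 1 := mul_inv_cancel₀ hβ0.ne'
  unfold betaMap
  split_ifs with h
  · refine ⟨⟨?_, ?_⟩, ?_, ?_⟩ <;> simp <;> nlinarith
  · push Not at h
    refine ⟨⟨?_, ?_⟩, ?_, ?_⟩ <;> simp <;> nlinarith

/-! The `n`-th image of the square lies in strips of height `τ ^ n` and total width `β ^ n`, at most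
`2 ^ n` in number.

Upper bound: as `2 < β / τ`, at most `2 * (β / τ) ^ n` squares of side `τ ^ n` cover the strips.
With `d` the claimed dimension, `(τ ^ n) ^ d = (τ / β) ^ n`, so `μH[d]` is finite.

Lower bound: widths are at most 1, so level `n` has at least `β ^ n` strips. The count grows only by
splittings, each creating a strip of full width. Hence for `γ < β` some level `k` has at least `γ ^
k` full strips (`exists_pow_le_fullStrips_length`). Returning to full strips every `k` steps puts
`(0, 1] × K` inside the attractor, with `K` the self-similar set of the maps `y ↦ τ ^ k * y + b`
(`addressPoint_mem_betaAttractor`). Since `τ < 1 / 2` these maps are strongly separated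
(`betaStrips_separated`), and mass distribution for Lebesgue times Bernoulli
(`hausdorffMeasure_ne_zero_of_segment_prod`) bounds the dimension below by `1 + log γ / log τ⁻¹`.
Then `γ → β`. -/

/-- The horizontal strips making up the `n`-th image of the unit square: a pair `(a, b)` stands for
the strip `[0, a] × [b, b + τ ^ n]`. -/
noncomputable def betaStrips (β τ : ℝ) : ℕ → List (ℝ × ℝ)
  | 0 => [(1, 0)]
  | n + 1 => (betaStrips β τ n).flatMap fun s =>
      if s.1 ≤ β⁻¹ then [(β * s.1, τ * s.2)]
      else [(1, τ * s.2), (β * s.1 - 1, τ * s.2 + (1 - τ))]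

/-- The strips of full width. -/
noncomputable def fullStrips (β τ : ℝ) (n : ℕ) : List (ℝ × ℝ) :=
  (betaStrips β τ n).filter fun s => s.1 = 1

/-! ### Combinatorics and geometry of the strips. -/

section Strips

variable {β τ : ℝ}

theorem mem_betaStrips_succ {n : ℕ} {s : ℝ × ℝ} :
    s ∈ betaStrips β τ (n + 1) ↔ ∃ r ∈ betaStrips β τ n,
      (r.1 ≤ β⁻¹ ∧ s = (β * r.1, τ * r.2)) ∨
      (β⁻¹ < r.1 ∧ (s = (1, τ * r.2) ∨ s = (β * r.1 - 1, τ * r.2 + (1 - τ)))) := by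
  simp only [betaStrips, List.mem_flatMap]
  refine exists_congr fun r => and_congr_right fun _ => ?_
  split_ifs with h
  · simp [h]
  · simp [h, not_le.1 h]

theorem betaStrips_bounds (hβ : β ∈ Set.Ioo (1 : ℝ) 2) (hτ : τ ∈ Set.Ioo (0 : ℝ) (1 / 2)) (n : ℕ) :
    ∀ s ∈ betaStrips β τ n, 0 < s.1 ∧ s.1 ≤ 1 ∧ 0 ≤ s.2 ∧ s.2 ≤ 1 - τ ^ n := by
  obtain ⟨hβ1, hβ2⟩ := hβ
  obtain ⟨hτ1, hτ2⟩ := hτ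
  have hβ0 : 0 < β := by linarith
  have hc : β * β⁻¹ = 1 := mul_inv_cancel₀ hβ0.ne'
  induction n with
  | zero => simp [betaStrips]
  | succ n ih =>
    intro s hs
    obtain ⟨⟨a, b⟩, hr, h⟩ := mem_betaStrips_succ.1 hs
    obtain ⟨ha0, ha1, hb0, hb1⟩ := ih _ hr
    have hp : 0 < τ ^ n := by positivity
    have hb2 : τ * b ≤ τ - τ ^ (n + 1) := by rw [pow_succ]; nlinarith
    have hb3 : 0 ≤ τ * b := by positivity
    rcases h with ⟨h, rfl⟩ | ⟨h, rfl | rfl⟩ <;> refine ⟨?_, ?_, ?_, ?_⟩ <;> simp_all <;> nlinarith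

/-- A split preserves the stretched width: `1 + (β * a - 1) = β * a`. -/
theorem betaStrips_sum_width (n : ℕ) :
    ((betaStrips β τ n).map Prod.fst).sum = β ^ n := by
  have key : ∀ l : List (ℝ × ℝ), ((l.flatMap fun s =>
      if s.1 ≤ β⁻¹ then [(β * s.1, τ * s.2)]
      else [(1, τ * s.2), (β * s.1 - 1, τ * s.2 + (1 - τ))]).map Prod.fst).sum
      = β * (l.map Prod.fst).sum := by
    intro l
    induction l with
    | nil => simp
    | cons s l ih =>
      rw [List.flatMap_cons, List.map_append, List.sum_append, ih]
      split_ifs <;> simp <;> ring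
  induction n with
  | zero => simp [betaStrips]
  | succ n ih => rw [betaStrips, key, ih, pow_succ, mul_comm]

theorem betaStrips_length_le (n : ℕ) : (betaStrips β τ n).length ≤ 2 ^ n := by
  have key : ∀ l : List (ℝ × ℝ), (l.flatMap fun s =>
      if s.1 ≤ β⁻¹ then [(β * s.1, τ * s.2)]
      else [(1, τ * s.2), (β * s.1 - 1, τ * s.2 + (1 - τ))]).length ≤ 2 * l.length := by
    intro l
    induction l with
    | nil => simp
    | cons s l ih =>
      rw [List.flatMap_cons, List.length_append, List.length_cons]
      split_ifs <;> simp only [List.length_cons, List.length_nil] <;> omega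
  induction n with
  | zero => simp [betaStrips]
  | succ n ih => rw [betaStrips, pow_succ]; exact (key _).trans (by omega)

/-- Every splitting of a strip creates a strip of full width. -/
theorem betaStrips_length_le_sum_fullStrips (n : ℕ) :
    (betaStrips β τ n).length ≤ ∑ i ∈ Finset.range (n + 1), (fullStrips β τ i).length := by
  have key : ∀ l : List (ℝ × ℝ), (l.flatMap fun s =>
      if s.1 ≤ β⁻¹ then [(β * s.1, τ * s.2)]
      else [(1, τ * s.2), (β * s.1 - 1, τ * s.2 + (1 - τ))]).length ≤ l.length +
      ((l.flatMap fun s =>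
      if s.1 ≤ β⁻¹ then [(β * s.1, τ * s.2)]
      else [(1, τ * s.2), (β * s.1 - 1, τ * s.2 + (1 - τ))]).filter fun s => s.1 = 1).length := by
    intro l
    induction l with
    | nil => simp
    | cons s l ih =>
      rw [List.flatMap_cons, List.filter_append, List.length_append, List.length_append,
        List.length_cons]
      split_ifs
      · simp only [List.length_cons, List.length_nil]; omega
      · rw [List.filter_cons_of_pos (by simp)]
        simp only [List.length_cons, List.length_nil]; omega
  induction n with
  | zero => simp [betaStrips, fullStrips]
  | succ n ih =>
    rw [Finset.sum_range_succ]
    exact (key (betaStrips β τ n)).trans (Nat.add_le_add_right ih _)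

/-- Otherwise `β ^ n ≤ (n + 1) * γ ^ n` for all `n`, which fails for large `n`. The condition `1 ≤
k` makes `τ ^ k` a contraction ratio. -/
theorem exists_pow_le_fullStrips_length (hβ : β ∈ Set.Ioo (1 : ℝ) 2)
    (hτ : τ ∈ Set.Ioo (0 : ℝ) (1 / 2)) {γ : ℝ} (hγ1 : 1 ≤ γ) (hγ : γ < β) :
    ∃ k, 1 ≤ k ∧ γ ^ k ≤ ((fullStrips β τ k).length : ℝ) := by
  by_contra! H
  have hβ0 : 0 < β := by linarith
  have hbound : ∀ n : ℕ, β ^ n ≤ (n + 1) * γ ^ n := by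
    intro n
    calc β ^ n = ((betaStrips β τ n).map Prod.fst).sum := (betaStrips_sum_width n).symm
      _ ≤ ((betaStrips β τ n).map Prod.fst).length • (1 : ℝ) := by
        refine List.sum_le_card_nsmul _ _ fun x hx => ?_
        obtain ⟨s, hs, rfl⟩ := List.mem_map.1 hx
        exact (betaStrips_bounds hβ hτ n s hs).2.1
      _ = ((betaStrips β τ n).length : ℝ) := by simp
      _ ≤ ∑ i ∈ Finset.range (n + 1), ((fullStrips β τ i).length : ℝ) := by
        exact_mod_cast betaStrips_length_le_sum_fullStrips n
      _ ≤ ∑ i ∈ Finset.range (n + 1), γ ^ n := by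
        refine Finset.sum_le_sum fun i hi => ?_
        rcases Nat.eq_zero_or_pos i with rfl | hi0
        · simpa [fullStrips, betaStrips] using one_le_pow₀ hγ1
        · exact (H i hi0).le.trans
            (pow_le_pow_right₀ hγ1 (Nat.lt_succ_iff.1 (Finset.mem_range.1 hi)))
      _ = (n + 1) * γ ^ n := by simp
  have hr0 : 0 ≤ γ / β := by positivity
  have hr1 : γ / β < 1 := (div_lt_one hβ0).2 hγ
  have hlim : Filter.Tendsto (fun n : ℕ => (n : ℝ) * (γ / β) ^ n + (γ / β) ^ n) Filter.atTop
      (nhds (0 + 0)) :=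
    (tendsto_self_mul_const_pow_of_lt_one hr0 hr1).add (tendsto_pow_atTop_nhds_zero_of_lt_one hr0 hr1)
  obtain ⟨n, hn⟩ := (hlim.eventually_lt_const (u := 1) (by norm_num)).exists
  have h := hbound n
  rw [div_pow, ← add_one_mul, ← mul_div_assoc, div_lt_one (by positivity)] at hn
  linarith

/-- The factor `2 * (1 - τ)` exceeds 1, so distinct strips have a gap proportional to their height.
-/
theorem betaStrips_separated (hβ : β ∈ Set.Ioo (1 : ℝ) 2) (hτ : τ ∈ Set.Ioo (0 : ℝ) (1 / 2))
    (n : ℕ) :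
    (betaStrips β τ n).Pairwise fun s r => 2 * (1 - τ) * τ ^ n ≤ |s.2 - r.2| := by
  have hτ1 := hτ.1
  have hτ2 := hτ.2
  induction n with
  | zero => simp [betaStrips]
  | succ n ih =>
    have hpow : τ ^ (n + 1) ≤ 1 := pow_le_one₀ hτ1.le (by linarith)
    -- Strips in different branches: the claim reduces to `(1 - 2 * τ) * (1 - τ ^ (n + 1)) ≥ 0`.
    have far : ∀ b b' : ℝ, 0 ≤ b → b ≤ 1 - τ ^ n → 0 ≤ b' → b' ≤ 1 - τ ^ n →
        2 * (1 - τ) * τ ^ (n + 1) ≤ τ * b + (1 - τ) - τ * b' := by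
      intro b b' h1 h2 h3 h4
      have : τ * b' ≤ τ - τ ^ (n + 1) := by rw [pow_succ]; nlinarith
      have : 0 ≤ τ * b := by positivity
      nlinarith
    rw [betaStrips, List.pairwise_flatMap]
    constructor
    · rintro ⟨a, b⟩ hs
      obtain ⟨-, -, hb0, hb1⟩ := betaStrips_bounds hβ hτ n _ hs
      split_ifs
      · simp
      · simp only [List.pairwise_cons, List.mem_cons, List.not_mem_nil, or_false, forall_eq,
          List.Pairwise.nil, and_true, false_imp_iff, implies_true]
        rw [abs_sub_comm]
        exact (far b b hb0 hb1 hb0 hb1).trans (le_abs_self _)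
    · refine ih.imp_of_mem ?_
      rintro ⟨a, b⟩ ⟨a', b'⟩ hs hr hsep x hx y hy
      obtain ⟨-, -, hb0, hb1⟩ := betaStrips_bounds hβ hτ n _ hs
      obtain ⟨-, -, hb0', hb1'⟩ := betaStrips_bounds hβ hτ n _ hr
      have near : 2 * (1 - τ) * τ ^ (n + 1) ≤ |τ * b - τ * b'| := by
        rw [← mul_sub, abs_mul, abs_of_pos hτ1, pow_succ]
        nlinarith
      have hx' : x.2 = τ * b ∨ x.2 = τ * b + (1 - τ) := by split_ifs at hx <;> aesop
      have hy' : y.2 = τ * b' ∨ y.2 = τ * b' + (1 - τ) := by split_ifs at hy <;> aesop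
      rcases hx' with hx' | hx' <;> rcases hy' with hy' | hy' <;> rw [hx', hy']
      · exact near
      · rw [abs_sub_comm]
        exact (far b' b hb0' hb1' hb0 hb1).trans (le_abs_self _)
      · exact (far b b' hb0 hb1 hb0' hb1').trans (le_abs_self _)
      · rwa [add_sub_add_right_eq_sub]

theorem iterate_betaMap_image_subset (hβ : β ∈ Set.Ioo (1 : ℝ) 2)
    (hτ : τ ∈ Set.Ioo (0 : ℝ) (1 / 2)) (n : ℕ) {p : EuclideanSpace ℝ (Fin 2)}
    (hp : p ∈ (betaMap β τ)^[n] '' unitSquare) :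
    ∃ s ∈ betaStrips β τ n, p 0 ∈ Set.Icc 0 s.1 ∧ p 1 ∈ Set.Icc s.2 (s.2 + τ ^ n) := by
  have hτ1 := hτ.1
  have hβ0 : 0 < β := by linarith [hβ.1]
  have hc : β * β⁻¹ = 1 := mul_inv_cancel₀ hβ0.ne'
  induction n generalizing p with
  | zero =>
    obtain ⟨q, ⟨hq0, hq1⟩, rfl⟩ := hp
    exact ⟨(1, 0), by simp [betaStrips], by simpa using hq0, by simpa using hq1⟩
  | succ n ih =>
    obtain ⟨q, hq, rfl⟩ := hp
    rw [Function.iterate_succ_apply']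
    obtain ⟨⟨a, b⟩, hs, ⟨hx0, hx1⟩, hy0, hy1⟩ := ih ⟨q, hq, rfl⟩
    generalize (betaMap β τ)^[n] q = r at *
    have hy0' : τ * b ≤ τ * r 1 := mul_le_mul_of_nonneg_left hy0 hτ1.le
    have hy1' : τ * r 1 ≤ τ * b + τ ^ (n + 1) := by
      rw [pow_succ, mul_comm (τ ^ n), ← mul_add]; exact mul_le_mul_of_nonneg_left hy1 hτ1.le
    have hx0' : 0 ≤ β * r 0 := by positivity
    have hx1' : β * r 0 ≤ β * a := mul_le_mul_of_nonneg_left hx1 hβ0.le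
    unfold betaMap
    split_ifs with h
    · have h' : β * r 0 ≤ 1 := by rw [← hc]; exact mul_le_mul_of_nonneg_left h hβ0.le
      by_cases ha : a ≤ β⁻¹
      · exact ⟨_, mem_betaStrips_succ.2 ⟨_, hs, Or.inl ⟨ha, rfl⟩⟩, by simpa using ⟨hx0', hx1'⟩,
          by simpa using ⟨hy0', hy1'⟩⟩
      · exact ⟨_, mem_betaStrips_succ.2 ⟨_, hs, Or.inr ⟨not_le.1 ha, Or.inl rfl⟩⟩,
          by simpa using ⟨hx0', h'⟩, by simpa using ⟨hy0', hy1'⟩⟩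
    · have h := not_le.1 h
      have h' : 1 < β * r 0 := by rw [← hc]; exact mul_lt_mul_of_pos_left h hβ0
      refine ⟨_, mem_betaStrips_succ.2 ⟨_, hs, Or.inr ⟨h.trans_le hx1, Or.inr rfl⟩⟩, ?_, ?_⟩
      · simp; constructor <;> linarith
      · simp; constructor <;> linarith

/-- Each strip of width `a` is attained over `(0, a]`, by points with arbitrary height. -/
theorem exists_iterate_betaMap_eq (hβ : β ∈ Set.Ioo (1 : ℝ) 2) (n : ℕ) :
    ∀ s ∈ betaStrips β τ n, ∀ x ∈ Set.Ioc 0 s.1, ∃ x' ∈ Set.Ioc (0 : ℝ) 1, ∀ y : ℝ,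
      (betaMap β τ)^[n] !₂[x', y] = !₂[x, τ ^ n * y + s.2] := by
  have hβ0 : 0 < β := by linarith [hβ.1]
  induction n with
  | zero =>
    intro s hs x hx
    obtain rfl : s = (1, 0) := by simpa [betaStrips] using hs
    exact ⟨x, hx, fun y => by simp⟩
  | succ n ih =>
    intro s hs x hx
    obtain ⟨⟨a, b⟩, hr, h⟩ := mem_betaStrips_succ.1 hs
    have low : x ≤ β * a → x ≤ 1 → ∃ x' ∈ Set.Ioc (0 : ℝ) 1, ∀ y : ℝ,
        (betaMap β τ)^[n + 1] !₂[x', y] = !₂[x, τ ^ (n + 1) * y + τ * b] := by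
      intro h1 h2
      obtain ⟨x', hx', H⟩ := ih _ hr (x / β) ⟨div_pos hx.1 hβ0, (div_le_iff₀' hβ0).2 h1⟩
      refine ⟨x', hx', fun y => ?_⟩
      rw [Function.iterate_succ_apply', H, betaMap, if_pos]
      · simp only [Matrix.cons_val_zero, Matrix.cons_val_one]
        rw [mul_div_cancel₀ _ hβ0.ne']
        congr 3; ring
      · simpa [div_eq_mul_inv] using mul_le_of_le_one_left (inv_nonneg.2 hβ0.le) h2
    rcases h with ⟨h, rfl⟩ | ⟨h, rfl | rfl⟩
    · refine low hx.2 (hx.2.trans ?_)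
      rw [← mul_inv_cancel₀ hβ0.ne']
      exact mul_le_mul_of_nonneg_left h hβ0.le
    · refine low (hx.2.trans ?_) hx.2
      have := mul_le_mul_of_nonneg_left h.le hβ0.le
      rwa [mul_inv_cancel₀ hβ0.ne'] at this
    · have h1 : x + 1 ≤ β * a := by have := hx.2; simp only at this; linarith
      have h0 : 0 < x := hx.1
      obtain ⟨x', hx', H⟩ := ih _ hr ((x + 1) / β) ⟨by positivity, (div_le_iff₀' hβ0).2 h1⟩
      refine ⟨x', hx', fun y => ?_⟩
      rw [Function.iterate_succ_apply', H, betaMap, if_neg]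
      · simp only [Matrix.cons_val_zero, Matrix.cons_val_one]
        rw [mul_div_cancel₀ _ hβ0.ne', add_sub_cancel_right]
        congr 3; ring
      -- The right branch requires `(x + 1) / β > β⁻¹`, hence `x > 0`; this is why the left endpoint
      -- is excluded.
      · simp only [Matrix.cons_val_zero, not_le]
        rw [inv_eq_one_div]
        exact div_lt_div_of_pos_right (by linarith) hβ0

end Strips

open MeasureTheory Filter Topology
open scoped ENNReal NNReal

theorem EuclideanSpace.dist_fin_two_le (p q : EuclideanSpace ℝ (Fin 2)) :
    dist p q ≤ |p 0 - q 0| + |p 1 - q 1| := by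
  rw [EuclideanSpace.dist_eq, Fin.sum_univ_two, Real.dist_eq, Real.dist_eq]
  refine Real.sqrt_le_iff.2 ⟨by positivity, ?_⟩
  nlinarith [abs_nonneg (p 0 - q 0), abs_nonneg (p 1 - q 1)]

theorem EuclideanSpace.abs_sub_apply_le_dist {n : ℕ} (p q : EuclideanSpace ℝ (Fin n)) (i : Fin n) :
    |p i - q i| ≤ dist p q := by
  rw [dist_eq_norm]
  simpa using PiLp.norm_apply_le (p - q) i

theorem Real.rpow_one_add_log_div_log_inv {τ γ : ℝ} (hτ0 : 0 < τ) (hτ1 : τ < 1) (hγ : 0 < γ) :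
    τ ^ (1 + Real.log γ / Real.log τ⁻¹) = τ / γ := by
  have hl : Real.log τ < 0 := Real.log_neg hτ0 hτ1
  rw [Real.rpow_add hτ0, Real.rpow_one, Real.rpow_def_of_pos hτ0, Real.log_inv, div_neg, mul_neg,
    mul_div_cancel₀ _ hl.ne, Real.exp_neg, Real.exp_log hγ, div_eq_mul_inv]

/-! ### Upper bound by covering with squares. -/

section UpperBound

variable {β τ : ℝ}

/-- The `j`-th square of side `δ` over the base line of height `b`. -/
def betaCell (δ b : ℝ) (j : ℕ) : Set (EuclideanSpace ℝ (Fin 2)) :=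
  {p | p 0 ∈ Set.Icc (j * δ) ((j + 1) * δ) ∧ p 1 ∈ Set.Icc b (b + δ)}

theorem ediam_betaCell_le (δ b : ℝ) (j : ℕ) :
    Metric.ediam (betaCell δ b j) ≤ ENNReal.ofReal (2 * δ) := by
  refine Metric.ediam_le fun p hp q hq => ?_
  rw [edist_dist]
  refine ENNReal.ofReal_le_ofReal ((EuclideanSpace.dist_fin_two_le p q).trans ?_)
  have h0 := abs_sub_le_of_le_of_le hp.1.1 hp.1.2 hq.1.1 hq.1.2
  have h1 := abs_sub_le_of_le_of_le hp.2.1 hp.2.2 hq.2.1 hq.2.2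
  linarith

theorem isClosed_betaCell (δ b : ℝ) (j : ℕ) : IsClosed (betaCell δ b j) :=
  (isClosed_Icc.preimage (by fun_prop)).inter (isClosed_Icc.preimage (by fun_prop))

theorem betaAttractor_subset_iUnion_betaCell (hβ : β ∈ Set.Ioo (1 : ℝ) 2)
    (hτ : τ ∈ Set.Ioo (0 : ℝ) (1 / 2)) (n : ℕ) :
    betaAttractor β τ ⊆ ⋃ i : (Σ i : Fin (betaStrips β τ n).length,
        Fin (⌊((betaStrips β τ n).get i).1 / τ ^ n⌋₊ + 1)),
      betaCell (τ ^ n) ((betaStrips β τ n).get i.1).2 i.2 := by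
  have hτn : 0 < τ ^ n := pow_pos hτ.1 n
  -- A finite union of closed cells absorbs the closure in the attractor.
  refine closure_minimal ?_ (isClosed_iUnion_of_finite fun i => isClosed_betaCell _ _ _)
  intro p hp
  obtain ⟨s, hs, hx, hy⟩ := iterate_betaMap_image_subset hβ hτ n (Set.mem_iInter.1 hp n)
  obtain ⟨i, rfl⟩ := List.mem_iff_get.1 hs
  have hle : p 0 / τ ^ n ≤ ((betaStrips β τ n).get i).1 / τ ^ n :=
    div_le_div_of_nonneg_right hx.2 hτn.le
  refine Set.mem_iUnion.2 ⟨⟨i, ⌊p 0 / τ ^ n⌋₊, Nat.lt_succ_of_le (Nat.floor_mono hle)⟩, ?_, hy⟩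
  exact ⟨(le_div_iff₀ hτn).1 (Nat.floor_le (div_nonneg hx.1 hτn.le)),
    (div_le_iff₀ hτn).1 (Nat.lt_floor_add_one _).le⟩

theorem sum_floor_betaStrips_le (hβ : β ∈ Set.Ioo (1 : ℝ) 2)
    (hτ : τ ∈ Set.Ioo (0 : ℝ) (1 / 2)) (n : ℕ) :
    ∑ i : Fin (betaStrips β τ n).length,
      ((⌊((betaStrips β τ n).get i).1 / τ ^ n⌋₊ + 1 : ℕ) : ℝ) ≤ 2 * (β / τ) ^ n := by
  have hτn : 0 < τ ^ n := pow_pos hτ.1 n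
  calc ∑ i : Fin (betaStrips β τ n).length,
        ((⌊((betaStrips β τ n).get i).1 / τ ^ n⌋₊ + 1 : ℕ) : ℝ)
      ≤ ∑ i : Fin (betaStrips β τ n).length, (((betaStrips β τ n).get i).1 / τ ^ n + 1) := by
        refine Finset.sum_le_sum fun i _ => ?_
        push_cast
        gcongr
        exact Nat.floor_le (div_nonneg
          (betaStrips_bounds hβ hτ n _ (List.get_mem _ _)).1.le hτn.le)
    _ = ((betaStrips β τ n).map Prod.fst).sum / τ ^ n + (betaStrips β τ n).length := by
        rw [Finset.sum_add_distrib, ← Finset.sum_div]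
        congr 2
        · conv_rhs => rw [← List.ofFn_get (betaStrips β τ n), List.map_ofFn, List.sum_ofFn]
          rfl
        · simp
    _ ≤ (β / τ) ^ n + (β / τ) ^ n := by
        rw [betaStrips_sum_width, div_pow]
        gcongr
        rw [← div_pow]
        calc ((betaStrips β τ n).length : ℝ) ≤ 2 ^ n := mod_cast betaStrips_length_le n
          _ ≤ (β / τ) ^ n := by
            gcongr
            rw [le_div_iff₀ hτ.1]
            linarith [hτ.2, hβ.1]
    _ = _ := by ring

theorem dimH_betaAttractor_le (hβ : β ∈ Set.Ioo (1 : ℝ) 2) (hτ : τ ∈ Set.Ioo (0 : ℝ) (1 / 2)) :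
    dimH (betaAttractor β τ) ≤ ENNReal.ofReal (1 + Real.log β / Real.log τ⁻¹) := by
  have hτ0 := hτ.1
  have hτ1 : τ < 1 := by linarith [hτ.2]
  have hβ0 : 0 < β := by linarith [hβ.1]
  set d : ℝ := 1 + Real.log β / Real.log τ⁻¹ with hd
  have hd0 : 0 ≤ d := by
    have h1 : 0 ≤ Real.log β := Real.log_nonneg hβ.1.le
    have h2 : 0 ≤ Real.log τ⁻¹ := Real.log_nonneg ((one_le_inv₀ hτ0).2 hτ1.le)
    positivity
  have hlim : Tendsto (fun n : ℕ => ENNReal.ofReal (2 * τ ^ n)) atTop (𝓝 0) := by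
    have := ENNReal.tendsto_ofReal
      ((tendsto_pow_atTop_nhds_zero_of_lt_one hτ0.le hτ1).const_mul 2)
    simpa using this
  have key := Measure.hausdorffMeasure_le_liminf_sum d (betaAttractor β τ) _ hlim
    (fun n (i : Σ i : Fin (betaStrips β τ n).length,
        Fin (⌊((betaStrips β τ n).get i).1 / τ ^ n⌋₊ + 1)) =>
      betaCell (τ ^ n) ((betaStrips β τ n).get i.1).2 i.2)
    (Eventually.of_forall fun n i => ediam_betaCell_le _ _ _)
    (Eventually.of_forall fun n => betaAttractor_subset_iUnion_betaCell hβ hτ n)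
  have hsum : ∀ n : ℕ, ∑ i : (Σ i : Fin (betaStrips β τ n).length,
        Fin (⌊((betaStrips β τ n).get i).1 / τ ^ n⌋₊ + 1)),
      Metric.ediam (betaCell (τ ^ n) ((betaStrips β τ n).get i.1).2 i.2) ^ d
      ≤ ENNReal.ofReal (2 * 2 ^ d) := by
    intro n
    have hτn : 0 < τ ^ n := pow_pos hτ0 n
    have hpow : (τ ^ n) ^ d = (τ / β) ^ n := by
      rw [← Real.rpow_natCast, ← Real.rpow_mul hτ0.le, mul_comm, Real.rpow_mul hτ0.le, hd,
        Real.rpow_one_add_log_div_log_inv hτ0 hτ1 hβ0, Real.rpow_natCast]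
    refine (Finset.sum_le_sum fun i _ =>
      ENNReal.rpow_le_rpow (ediam_betaCell_le _ _ _) hd0).trans ?_
    rw [ENNReal.ofReal_rpow_of_nonneg (by positivity) hd0,
      ← ENNReal.ofReal_sum_of_nonneg (fun _ _ => by positivity)]
    refine ENNReal.ofReal_le_ofReal ?_
    rw [Finset.sum_const, Finset.card_univ, Fintype.card_sigma, nsmul_eq_mul, Nat.cast_sum]
    simp only [Fintype.card_fin]
    calc _ ≤ 2 * (β / τ) ^ n * (2 * τ ^ n) ^ d := by
          gcongr
          exact sum_floor_betaStrips_le hβ hτ n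
      _ = 2 * 2 ^ d * ((β / τ) * (τ / β)) ^ n := by
          rw [Real.mul_rpow (by norm_num) hτn.le, hpow, mul_pow]; ring
      _ = 2 * 2 ^ d := by
          rw [div_mul_div_cancel₀ hτ0.ne', div_self hβ0.ne', one_pow, mul_one]
  have hfin : μH[d] (betaAttractor β τ) ≤ ENNReal.ofReal (2 * 2 ^ d) :=
    key.trans (liminf_le_of_frequently_le' (Eventually.of_forall hsum).frequently)
  have hcoe : ((d.toNNReal : ℝ≥0) : ℝ) = d := Real.coe_toNNReal d hd0
  exact dimH_le_of_hausdorffMeasure_ne_top (d := d.toNNReal)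
    (by rw [hcoe]; exact (hfin.trans_lt ENNReal.ofReal_lt_top).ne)

end UpperBound

/-! ### Mass distribution on a segment times a self-similar set. -/

section SelfSimilar

/-- The point of the self-similar set of the maps `y ↦ ρ * y + b i` with address `ω`. -/
noncomputable def addressPoint {c : ℕ} (ρ : ℝ) (b : Fin c → ℝ) (ω : ℕ → Fin c) : ℝ :=
  ∑' j, ρ ^ j * b (ω j)

variable {c : ℕ} {ρ : ℝ} {b : Fin c → ℝ}

theorem norm_addressPoint_term_le (hρ0 : 0 < ρ) (hb : ∀ i, b i ∈ Set.Icc 0 (1 - ρ)) (j : ℕ)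
    (ω : ℕ → Fin c) : ‖ρ ^ j * b (ω j)‖ ≤ ρ ^ j * (1 - ρ) := by
  rw [Real.norm_of_nonneg (mul_nonneg (by positivity) (hb _).1)]
  exact mul_le_mul_of_nonneg_left (hb _).2 (by positivity)

theorem summable_addressPoint (hρ0 : 0 < ρ) (hρ1 : ρ < 1) (hb : ∀ i, b i ∈ Set.Icc 0 (1 - ρ))
    (ω : ℕ → Fin c) : Summable fun j => ρ ^ j * b (ω j) :=
  .of_norm_bounded ((summable_geometric_of_lt_one hρ0.le hρ1).mul_right _)
    fun j => norm_addressPoint_term_le hρ0 hb j ω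

theorem addressPoint_eq (hρ0 : 0 < ρ) (hρ1 : ρ < 1) (hb : ∀ i, b i ∈ Set.Icc 0 (1 - ρ))
    (ω : ℕ → Fin c) :
    addressPoint ρ b ω = ρ * addressPoint ρ b (fun j => ω (j + 1)) + b (ω 0) := by
  rw [addressPoint, (summable_addressPoint hρ0 hρ1 hb ω).tsum_eq_zero_add, addressPoint,
    ← tsum_mul_left, add_comm]
  congr 1
  · exact tsum_congr fun j => by ring
  · simp

theorem addressPoint_mem_Icc (hρ0 : 0 < ρ) (hρ1 : ρ < 1) (hb : ∀ i, b i ∈ Set.Icc 0 (1 - ρ))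
    (ω : ℕ → Fin c) : addressPoint ρ b ω ∈ Set.Icc 0 1 := by
  refine ⟨tsum_nonneg fun j => mul_nonneg (by positivity) (hb _).1, ?_⟩
  calc addressPoint ρ b ω ≤ ∑' j, ρ ^ j * (1 - ρ) :=
        (summable_addressPoint hρ0 hρ1 hb ω).tsum_le_tsum
          (fun j => mul_le_mul_of_nonneg_left (hb _).2 (by positivity))
          ((summable_geometric_of_lt_one hρ0.le hρ1).mul_right _)
    _ = 1 := by
        rw [tsum_mul_right, tsum_geometric_of_lt_one hρ0.le hρ1, inv_mul_cancel₀ (by linarith)]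

theorem measurable_addressPoint (hρ0 : 0 < ρ) (hρ1 : ρ < 1)
    (hb : ∀ i, b i ∈ Set.Icc 0 (1 - ρ)) : Measurable (addressPoint ρ b) := by
  have : Continuous (addressPoint ρ b) := by
    refine continuous_tsum (fun j => ?_) ((summable_geometric_of_lt_one hρ0.le hρ1).mul_right _)
      (norm_addressPoint_term_le hρ0 hb)
    exact continuous_const.mul (continuous_of_discreteTopology.comp (continuous_apply j))
  exact this.measurable

/-- If the first digits differ, the separation `(1 + δ) * ρ` exceeds the tail contribution, at most
`ρ`, by `δ * ρ`. Otherwise cancel the digit, rescale by `ρ` and induct. -/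
theorem address_eq_of_abs_sub_lt (hρ0 : 0 < ρ) (hρ1 : ρ < 1) (hb : ∀ i, b i ∈ Set.Icc 0 (1 - ρ))
    {δ : ℝ} (hδ : 0 < δ) (hsep : ∀ i j, i ≠ j → (1 + δ) * ρ ≤ |b i - b j|) (m : ℕ) :
    ∀ ω ω' : ℕ → Fin c, |addressPoint ρ b ω - addressPoint ρ b ω'| < δ * ρ ^ m →
      ∀ j < m, ω j = ω' j := by
  induction m with
  | zero => simp
  | succ m ih =>
    intro ω ω' h
    rw [addressPoint_eq hρ0 hρ1 hb ω, addressPoint_eq hρ0 hρ1 hb ω'] at h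
    set u := addressPoint ρ b fun j => ω (j + 1)
    set v := addressPoint ρ b fun j => ω' (j + 1)
    have hu : u ∈ Set.Icc 0 1 := addressPoint_mem_Icc hρ0 hρ1 hb _
    have hv : v ∈ Set.Icc 0 1 := addressPoint_mem_Icc hρ0 hρ1 hb _
    have huv : |u - v| ≤ 1 := by rw [abs_le]; constructor <;> linarith [hu.1, hu.2, hv.1, hv.2]
    have h0 : ω 0 = ω' 0 := by
      by_contra hne
      have h1 := hsep _ _ hne
      have h2 : |b (ω 0) - b (ω' 0)| ≤
          |ρ * u + b (ω 0) - (ρ * v + b (ω' 0))| + |ρ * (v - u)| := by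
        refine le_trans (le_of_eq ?_) (abs_add_le _ _)
        congr 1; ring
      rw [abs_mul, abs_of_pos hρ0, abs_sub_comm v] at h2
      have h3 : δ * ρ ^ (m + 1) ≤ δ * ρ := by
        gcongr
        exact pow_le_of_le_one hρ0.le hρ1.le (Nat.succ_ne_zero m)
      nlinarith
    rw [h0, add_sub_add_right_eq_sub, ← mul_sub, abs_mul, abs_of_pos hρ0, pow_succ, ← mul_assoc,
      mul_comm _ ρ] at h
    have htail := ih _ _ (lt_of_mul_lt_mul_left h hρ0.le)
    intro j hj
    cases j with
    | zero => exact h0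
    | succ j => exact htail j (by omega)

/-- The uniform Bernoulli measure on addresses. -/
noncomputable def bernoulliMeasure (c : ℕ) [NeZero c] : Measure (ℕ → Fin c) :=
  Measure.infinitePi fun _ => (PMF.uniformOfFintype (Fin c)).toMeasure

instance (c : ℕ) [NeZero c] : IsProbabilityMeasure (bernoulliMeasure c) :=
  inferInstanceAs (IsProbabilityMeasure (Measure.infinitePi _))

theorem bernoulliMeasure_cylinder (c : ℕ) [NeZero c] (ω : ℕ → Fin c) (m : ℕ) :
    bernoulliMeasure c {ω' | ∀ j < m, ω' j = ω j} = (c : ℝ≥0∞)⁻¹ ^ m := by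
  have : {ω' | ∀ j < m, ω' j = ω j} = Set.pi (Finset.range m) fun j => {ω j} := by
    ext; simp
  rw [this, bernoulliMeasure, Measure.infinitePi_pi _ fun _ _ => measurableSet_singleton _]
  simp

theorem bernoulliMeasure_preimage_Icc_le [NeZero c] (hρ0 : 0 < ρ) (hρ1 : ρ < 1)
    (hb : ∀ i, b i ∈ Set.Icc 0 (1 - ρ)) {δ : ℝ} (hδ : 0 < δ)
    (hsep : ∀ i j, i ≠ j → (1 + δ) * ρ ≤ |b i - b j|) (m : ℕ) {y r : ℝ}
    (hr : 2 * r < δ * ρ ^ m) :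
    bernoulliMeasure c (addressPoint ρ b ⁻¹' Set.Icc (y - r) (y + r)) ≤ (c : ℝ≥0∞)⁻¹ ^ m := by
  rcases Set.eq_empty_or_nonempty (addressPoint ρ b ⁻¹' Set.Icc (y - r) (y + r)) with h | ⟨ω, hω⟩
  · simp [h]
  · rw [← bernoulliMeasure_cylinder c ω m]
    refine measure_mono fun ω' hω' => address_eq_of_abs_sub_lt hρ0 hρ1 hb hδ hsep m ω' ω ?_
    refine lt_of_le_of_lt ?_ hr
    rw [abs_le]
    constructor <;> linarith [hω.1, hω.2, hω'.1, hω'.2]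

/-- The product of Lebesgue measure on `(0, 1]` and of the uniform self-similar measure. -/
noncomputable def segmentProdMeasure (c : ℕ) [NeZero c] (ρ : ℝ) (b : Fin c → ℝ) :
    Measure (EuclideanSpace ℝ (Fin 2)) :=
  ((volume.restrict (Set.Ioc (0 : ℝ) 1)).prod (bernoulliMeasure c)).map
    fun z => !₂[z.1, addressPoint ρ b z.2]

theorem measurable_segmentProd (hρ0 : 0 < ρ) (hρ1 : ρ < 1) (hb : ∀ i, b i ∈ Set.Icc 0 (1 - ρ)) :
    Measurable fun z : ℝ × (ℕ → Fin c) =>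
      (!₂[z.1, addressPoint ρ b z.2] : EuclideanSpace ℝ (Fin 2)) := by
  have h := measurable_addressPoint hρ0 hρ1 hb
  refine (WithLp.measurable_toLp 2 _).comp (measurable_pi_iff.2 fun i => ?_)
  fin_cases i
  · exact measurable_fst
  · exact h.comp measurable_snd

theorem segmentProdMeasure_le_of_ediam_le [NeZero c] (hρ0 : 0 < ρ) (hρ1 : ρ < 1)
    (hb : ∀ i, b i ∈ Set.Icc 0 (1 - ρ)) {δ : ℝ} (hδ : 0 < δ)
    (hsep : ∀ i j, i ≠ j → (1 + δ) * ρ ≤ |b i - b j|) (m : ℕ) {r : ℝ} (hr0 : 0 ≤ r)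
    (hr : 2 * r < δ * ρ ^ m) {E : Set (EuclideanSpace ℝ (Fin 2))}
    (hE : Metric.ediam E ≤ ENNReal.ofReal r) :
    segmentProdMeasure c ρ b E ≤ ENNReal.ofReal (2 * r) * (c : ℝ≥0∞)⁻¹ ^ m := by
  rcases E.eq_empty_or_nonempty with rfl | ⟨p, hp⟩
  · simp
  set R : Set (EuclideanSpace ℝ (Fin 2)) :=
    {q | q 0 ∈ Set.Icc (p 0 - r) (p 0 + r) ∧ q 1 ∈ Set.Icc (p 1 - r) (p 1 + r)}
  have hR : IsClosed R :=
    (isClosed_Icc.preimage (by fun_prop)).inter (isClosed_Icc.preimage (by fun_prop))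
  have hER : E ⊆ R := by
    intro q hq
    have hd : dist q p ≤ r := by
      rw [← ENNReal.ofReal_le_ofReal_iff hr0, ← edist_dist]
      exact (Metric.edist_le_ediam_of_mem hq hp).trans hE
    have h : ∀ i, q i ∈ Set.Icc (p i - r) (p i + r) := fun i => by
      have := abs_le.1 ((EuclideanSpace.abs_sub_apply_le_dist q p i).trans hd)
      exact ⟨by linarith [this.1], by linarith [this.2]⟩
    exact ⟨h 0, h 1⟩
  refine (measure_mono hER).trans ?_
  rw [segmentProdMeasure, Measure.map_apply (measurable_segmentProd hρ0 hρ1 hb) hR.measurableSet]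
  have : (fun z : ℝ × (ℕ → Fin c) =>
      (!₂[z.1, addressPoint ρ b z.2] : EuclideanSpace ℝ (Fin 2))) ⁻¹' R =
      Set.Icc (p 0 - r) (p 0 + r) ×ˢ (addressPoint ρ b ⁻¹' Set.Icc (p 1 - r) (p 1 + r)) := by
    ext z; simp [R]
  rw [this, Measure.prod_prod]
  gcongr
  · refine (Measure.restrict_apply_le _ _).trans ?_
    rw [Real.volume_Icc]
    exact ENNReal.ofReal_le_ofReal (by linarith)
  · exact bernoulliMeasure_preimage_Icc_le hρ0 hρ1 hb hδ hsep m hr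

/-- `S` need not be measurable, since only a lower bound for the pushforward is needed. -/
theorem segmentProdMeasure_apply_of_forall_mem [NeZero c] (hρ0 : 0 < ρ) (hρ1 : ρ < 1)
    (hb : ∀ i, b i ∈ Set.Icc 0 (1 - ρ)) {S : Set (EuclideanSpace ℝ (Fin 2))}
    (hS : ∀ x ∈ Set.Ioc (0 : ℝ) 1, ∀ ω, !₂[x, addressPoint ρ b ω] ∈ S) :
    1 ≤ segmentProdMeasure c ρ b S := by
  refine le_trans ?_ (Measure.le_map_apply (measurable_segmentProd hρ0 hρ1 hb).aemeasurable S)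
  refine le_trans ?_ (measure_mono (s := Set.Ioc (0 : ℝ) 1 ×ˢ Set.univ) fun z hz => hS _ hz.1 _)
  rw [Measure.prod_prod]
  simp

theorem hausdorffMeasure_ne_zero_of_segment_prod [NeZero c] (hρ0 : 0 < ρ) (hρ1 : ρ < 1)
    (hb : ∀ i, b i ∈ Set.Icc 0 (1 - ρ)) {δ : ℝ} (hδ : 0 < δ)
    (hsep : ∀ i j, i ≠ j → (1 + δ) * ρ ≤ |b i - b j|) {t : ℝ} (ht : 0 ≤ t)
    (hct : (c : ℝ)⁻¹ ≤ ρ ^ t) {S : Set (EuclideanSpace ℝ (Fin 2))}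
    (hS : ∀ x ∈ Set.Ioc (0 : ℝ) 1, ∀ ω, !₂[x, addressPoint ρ b ω] ∈ S) :
    μH[1 + t] S ≠ 0 := by
  set C : ℝ := 2 * (4 / (δ * ρ)) ^ t with hC
  have hC0 : 0 < C := by positivity
  have hc0 : (0 : ℝ) < c := by exact_mod_cast NeZero.pos c
  have key : (ENNReal.ofReal C)⁻¹ • segmentProdMeasure c ρ b ≤ μH[1 + t] := by
    refine Measure.le_hausdorffMeasure _ _ (ENNReal.ofReal (δ / 4))
      (ENNReal.ofReal_pos.2 (by positivity)) fun E hE => ?_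
    have hfin : Metric.ediam E ≠ ∞ := (hE.trans_lt ENNReal.ofReal_lt_top).ne
    obtain ⟨r, hr0, hr⟩ : ∃ r : ℝ, 0 ≤ r ∧ Metric.ediam E = ENNReal.ofReal r :=
      ⟨_, ENNReal.toReal_nonneg, (ENNReal.ofReal_toReal hfin).symm⟩
    rw [hr, ENNReal.ofReal_le_ofReal_iff (by positivity)] at hE
    rw [Measure.smul_apply, smul_eq_mul,
      ENNReal.inv_mul_le_iff (ENNReal.ofReal_pos.2 hC0).ne' ENNReal.ofReal_ne_top, hr,
      ENNReal.ofReal_rpow_of_nonneg hr0 (by positivity), ← ENNReal.ofReal_mul hC0.le]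
    rcases hr0.eq_or_lt with rfl | hr0
    · refine (segmentProdMeasure_le_of_ediam_le hρ0 hρ1 hb hδ hsep 0 le_rfl (by simpa) hr.le).trans
        ?_
      simp
    -- Choose `ρ ^ (m + 1) < 4 * r / δ ≤ ρ ^ m`. The 4 gives the strict `2 * r < δ * ρ ^ m`; the
    -- lower inequality produces the constant `C`.
    obtain ⟨m, hm1, hm2⟩ := exists_nat_pow_near_of_lt_one (x := 4 * r / δ) (y := ρ)
      (by positivity) (by rw [div_le_one hδ]; linarith) hρ0 hρ1
    rw [div_le_iff₀' hδ] at hm2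
    refine (segmentProdMeasure_le_of_ediam_le hρ0 hρ1 hb hδ hsep m hr0.le (by linarith)
      hr.le).trans ?_
    have hcm : (c : ℝ≥0∞)⁻¹ ^ m = ENNReal.ofReal ((c : ℝ)⁻¹ ^ m) := by
      rw [ENNReal.ofReal_pow (by positivity), ENNReal.ofReal_inv_of_pos hc0, ENNReal.ofReal_natCast]
    rw [hcm, ← ENNReal.ofReal_mul (by positivity)]
    refine ENNReal.ofReal_le_ofReal ?_
    have hbd : (c : ℝ)⁻¹ ^ m ≤ (4 / (δ * ρ)) ^ t * r ^ t := by
      calc (c : ℝ)⁻¹ ^ m ≤ (ρ ^ t) ^ m := by gcongr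
        _ = (ρ ^ m) ^ t := by
            rw [← Real.rpow_natCast, ← Real.rpow_natCast, ← Real.rpow_mul hρ0.le,
              ← Real.rpow_mul hρ0.le, mul_comm]
        _ ≤ (4 / (δ * ρ) * r) ^ t := by
            gcongr
            have h : 4 / (δ * ρ) * r = 4 * r / δ / ρ := by field_simp
            rw [h, le_div_iff₀ hρ0, ← pow_succ]
            exact hm1.le
        _ = _ := Real.mul_rpow (by positivity) hr0.le
    rw [Real.rpow_add hr0, Real.rpow_one, hC]
    calc 2 * r * (c : ℝ)⁻¹ ^ m ≤ 2 * r * ((4 / (δ * ρ)) ^ t * r ^ t) := by gcongr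
      _ = _ := by ring
  intro h0
  have h1 := Measure.le_iff'.1 key S
  rw [h0, Measure.smul_apply, smul_eq_mul, nonpos_iff_eq_zero, mul_eq_zero, ENNReal.inv_eq_zero]
    at h1
  have h2 := segmentProdMeasure_apply_of_forall_mem hρ0 hρ1 hb hS
  rcases h1 with h1 | h1
  · exact ENNReal.ofReal_ne_top h1
  · simp [h1] at h2

end SelfSimilar

/-! ### Lower bound from the full strips. -/

section LowerBound

variable {β τ : ℝ}

/-- Prepending a digit to the address is one application of `f^k` along a full strip. Full width
lets the preimage abscissa be any point of `(0, 1]`, so the construction repeats indefinitely. -/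
theorem addressPoint_mem_betaAttractor (hβ : β ∈ Set.Ioo (1 : ℝ) 2)
    (hτ : τ ∈ Set.Ioo (0 : ℝ) (1 / 2)) {k c : ℕ} (hk : 1 ≤ k) {b : Fin c → ℝ}
    (hb : ∀ i, (1, b i) ∈ betaStrips β τ k) {x : ℝ} (hx : x ∈ Set.Ioc (0 : ℝ) 1)
    (ω : ℕ → Fin c) : !₂[x, addressPoint (τ ^ k) b ω] ∈ betaAttractor β τ := by
  have hρ0 : 0 < τ ^ k := pow_pos hτ.1 k
  have hρ1 : τ ^ k < 1 := pow_lt_one₀ hτ.1.le (by linarith [hτ.2]) (by omega)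
  have hb' : ∀ i, b i ∈ Set.Icc 0 (1 - τ ^ k) := fun i =>
    (betaStrips_bounds hβ hτ k _ (hb i)).2.2
  have hmem : ∀ m : ℕ, ∀ x ∈ Set.Ioc (0 : ℝ) 1, ∀ ω : ℕ → Fin c,
      !₂[x, addressPoint (τ ^ k) b ω] ∈ (betaMap β τ)^[k * m] '' unitSquare := by
    intro m
    induction m with
    | zero =>
      intro x hx ω
      have h := addressPoint_mem_Icc hρ0 hρ1 hb' ω
      exact ⟨_, ⟨⟨hx.1.le, hx.2⟩, h⟩, rfl⟩
    | succ m ih =>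
      intro x hx ω
      obtain ⟨x', hx', H⟩ := exists_iterate_betaMap_eq hβ k _ (hb (ω 0)) x hx
      obtain ⟨q, hq, hqe⟩ := ih x' hx' fun j => ω (j + 1)
      refine ⟨q, hq, ?_⟩
      rw [mul_add, mul_one, add_comm, Function.iterate_add_apply, hqe, H,
        addressPoint_eq hρ0 hρ1 hb' ω]
  refine subset_closure (Set.mem_iInter.2 fun n => ?_)
  obtain ⟨q, hq, hqe⟩ := hmem n x hx ω
  -- The images decrease, so lying in the image of order `k * n ≥ n` suffices.
  obtain ⟨j, hj⟩ := Nat.exists_eq_add_of_le (Nat.le_mul_of_pos_left n hk)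
  rw [hj, Function.iterate_add_apply] at hqe
  exact ⟨_, (mapsTo_betaMap_unitSquare hβ hτ).iterate j hq, hqe⟩

theorem le_dimH_betaAttractor_of_lt (hβ : β ∈ Set.Ioo (1 : ℝ) 2)
    (hτ : τ ∈ Set.Ioo (0 : ℝ) (1 / 2)) {γ : ℝ} (hγ1 : 1 ≤ γ) (hγ : γ < β) :
    ENNReal.ofReal (1 + Real.log γ / Real.log τ⁻¹) ≤ dimH (betaAttractor β τ) := by
  have hτ0 := hτ.1
  have hτ1 : τ < 1 := by linarith [hτ.2]
  have hγ0 : 0 < γ := by linarith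
  obtain ⟨k, hk, hcard⟩ := exists_pow_le_fullStrips_length (τ := τ) hβ hτ hγ1 hγ
  set l := fullStrips β τ k with hl
  have hmem : ∀ i, (1, (l.get i).2) ∈ betaStrips β τ k := by
    intro i
    have h := List.mem_filter.1 (List.get_mem l i)
    have h1 : (l.get i).1 = 1 := by simpa using h.2
    rw [← h1]
    exact h.1
  -- The separation parameter is `δ = 1 - 2 * τ`.
  have hsep : ∀ i j, i ≠ j → (1 + (1 - 2 * τ)) * τ ^ k ≤ |(l.get i).2 - (l.get j).2| := by
    have hp : l.Pairwise fun s r => 2 * (1 - τ) * τ ^ k ≤ |s.2 - r.2| :=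
      (betaStrips_separated hβ hτ k).filter _
    have he : 1 + (1 - 2 * τ) = 2 * (1 - τ) := by ring
    rw [he]
    intro i j hij
    rcases lt_or_gt_of_ne hij with h | h
    · exact List.pairwise_iff_get.1 hp i j h
    · rw [abs_sub_comm]
      exact List.pairwise_iff_get.1 hp j i h
  have hlen : l.length ≠ 0 := by
    have : (0 : ℝ) < l.length := (pow_pos hγ0 k).trans_le hcard
    exact_mod_cast this.ne'
  have : NeZero l.length := ⟨hlen⟩
  set t := Real.log γ / Real.log τ⁻¹ with ht
  have ht0 : 0 ≤ t :=
    div_nonneg (Real.log_nonneg hγ1) (Real.log_nonneg ((one_le_inv₀ hτ0).2 hτ1.le))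
  have hτt : τ ^ t = γ⁻¹ := by
    have h := Real.rpow_one_add_log_div_log_inv hτ0 hτ1 hγ0
    rw [Real.rpow_add hτ0, Real.rpow_one, div_eq_mul_inv] at h
    exact mul_left_cancel₀ hτ0.ne' h
  have hct : (l.length : ℝ)⁻¹ ≤ (τ ^ k) ^ t := by
    rw [← Real.rpow_natCast, ← Real.rpow_mul hτ0.le, mul_comm, Real.rpow_mul hτ0.le, hτt,
      Real.rpow_natCast, inv_pow]
    exact inv_anti₀ (pow_pos hγ0 k) hcard
  have hne := hausdorffMeasure_ne_zero_of_segment_prod (pow_pos hτ0 k)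
    (pow_lt_one₀ hτ0.le hτ1 (by omega)) (fun i => (betaStrips_bounds hβ hτ k _ (hmem i)).2.2)
    (by linarith [hτ.2]) hsep ht0 hct
    (fun x hx ω => addressPoint_mem_betaAttractor hβ hτ hk hmem hx ω)
  have hcoe : (((1 + t).toNNReal : ℝ≥0) : ℝ) = 1 + t := Real.coe_toNNReal _ (by positivity)
  exact le_dimH_of_hausdorffMeasure_ne_zero (d := (1 + t).toNNReal) (by rwa [hcoe])

theorem le_dimH_betaAttractor (hβ : β ∈ Set.Ioo (1 : ℝ) 2) (hτ : τ ∈ Set.Ioo (0 : ℝ) (1 / 2)) :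
    ENNReal.ofReal (1 + Real.log β / Real.log τ⁻¹) ≤ dimH (betaAttractor β τ) := by
  have hβ0 : β ≠ 0 := by linarith [hβ.1]
  have hlim : Tendsto (fun γ => ENNReal.ofReal (1 + Real.log γ / Real.log τ⁻¹)) (𝓝[<] β)
      (𝓝 (ENNReal.ofReal (1 + Real.log β / Real.log τ⁻¹))) :=
    (ENNReal.tendsto_ofReal
      (((Real.continuousAt_log hβ0).tendsto.div_const _).const_add 1)).mono_left nhdsWithin_le_nhds
  refine le_of_tendsto hlim ?_
  filter_upwards [Ioo_mem_nhdsLT hβ.1] with γ hγ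
  exact le_dimH_betaAttractor_of_lt hβ hτ hγ.1.le hγ.2

end LowerBound

theorem mainTheorem1 (β τ : ℝ) (hβ : β ∈ Set.Ioo (1 : ℝ) 2) (hτ : τ ∈ Set.Ioo (0 : ℝ) (1 / 2)) :
    dimH (betaAttractor β τ) = ENNReal.ofReal (1 + Real.log β / Real.log τ⁻¹) :=
  le_antisymm (dimH_betaAttractor_le hβ hτ) (le_dimH_betaAttractor hβ hτ)
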